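/- Let $D=\{z\in\mathbb{C}:|z|\le 1\}$ be the closed unit disk. For $n\in\mathbb{N}$ and real $M>0$, let $\mathbb{Z}_n^s(D,M)$ be the set of polynomials $P_n(z)=\sum_{k=0}^n a_{k,n}z^k$ with integer coefficients, of exact degree $n$, whose complex zeros are all simple and lie in $D$, and with $|a_{n,n}|\le M$. (i) For every real $M>0$, every integer $n\ge\max(M,55)$ and every $P_n\in\mathbb{Z}_n^s(D,M)$, $$|a_{n-1,n}|\le 8M\sqrt{n\log n}.$$ (ii) This bound is sharp up to the factor $\log n$: there is an absolute constant $c>0$ such that for every real $M\ge 1$ there are infinitely many $n$ for which some $P_n\in\mathbb{Z}_n^s(D,M)$ satisfies $$|a_{n-1,n}|\ge c\,M\sqrt{\frac{n}{\log n}}.$$ -/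

import Mathlib

open Polynomial Filter

/-- `ℤ_n(E)`: polynomials with integer coefficients, of exact degree `n`, all of whose complex
zeros lie in `E`. -/
def intPolys (n : ℕ) (E : Set ℂ) : Set ℤ[X] :=
  {P | P.degree = n ∧ ∀ z : ℂ, aeval z P = 0 → z ∈ E}

/-- `ℤ_n^s(E)`: the members of `ℤ_n(E)` with simple zeros, i.e. the multiset of complex zeros,
counted with multiplicity, has no repeated element. -/
def intPolysSimple (n : ℕ) (E : Set ℂ) : Set ℤ[X] :=
  {P | P ∈ intPolys n E ∧ (P.map (Int.castRingHom ℂ)).roots.Nodup}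

/-- `ℤ_n^s(E, M)`: the members of `ℤ_n^s(E)` whose leading coefficient has absolute value at
most `M`. -/
def intPolysSimpleBdd (n : ℕ) (E : Set ℂ) (M : ℝ) : Set ℤ[X] :=
  {P | P ∈ intPolysSimple n E ∧ |(P.coeff n : ℝ)| ≤ M}

/-!
Let `S` be the set of zeros of `P`, with `n = #S`, so that `|a_{n-1}| = |a_n| |∑ z ∈ S, z|`.

For the upper bound, `Res(P, P')` is a nonzero integer, so `|a_n| ^ (2n - 1) ∏_{z ≠ w} |z - w| ≥ 1`:
the logarithmic energy of the zeros is at most `(2n - 1) log |a_n| ≤ 2 n log n`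
(`one_le_norm_leadingCoeff_pow_mul_prod_sub`). On the closed unit disk `|z - w|` is at most
`2 / (1 + ρ) * |1 - ρ z w̄|` for `0 ≤ ρ < 1`, so it can be replaced by the smooth positive definite
kernel `|1 - ρ z w̄|`, whose diagonal terms are finite (`sum_neg_log_norm_regularized_le`).
Expanding the logarithm, the energy for this kernel is `∑ m ≥ 1, (ρ ^ m / m) |∑ z ∈ S, z ^ m|²`,
hence at least `ρ |∑ z ∈ S, z|²` (`mul_sq_norm_sum_le_energy`). The choice `ρ = 1 - 1 / n` gives
`|∑ z ∈ S, z|² = O(n log n)`.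

For the lower bound, take `⌊M⌋` times the product of the cyclotomic polynomials `Φ_q` over the
primes `q ≤ p`. Each factor contributes `1` to the second coefficient, which is therefore
`⌊M⌋ π(p)`, while the degree `n` is at most `p π(p)`; Chebyshev's lower bound for `π` then gives
`√(n / log n) ≤ 3 π(p)` (`sqrt_sum_div_log_le_primeCounting`).
-/

open scoped ComplexConjugate

/-! ### The regularized kernel on the unit disk -/

lemma re_sq_add_im_sq_le_one {z : ℂ} (hz : ‖z‖ ≤ 1) : z.re ^ 2 + z.im ^ 2 ≤ 1 := by
  have := Complex.sq_norm z
  rw [Complex.normSq_apply] at this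
  nlinarith [norm_nonneg z]

/-- On the closed unit disk, `|1 - z w̄|² - |z - w|² = (1 - |z|²)(1 - |w|²) ≥ 0`. -/
lemma norm_sub_le_norm_one_sub_mul_conj {z w : ℂ} (hz : ‖z‖ ≤ 1) (hw : ‖w‖ ≤ 1) :
    ‖z - w‖ ≤ ‖1 - z * conj w‖ := by
  have hz2 := re_sq_add_im_sq_le_one hz
  have hw2 := re_sq_add_im_sq_le_one hw
  refine abs_le_of_sq_le_sq' ?_ (norm_nonneg _) |>.2
  rw [Complex.sq_norm, Complex.sq_norm, Complex.normSq_apply, Complex.normSq_apply]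
  simp
  nlinarith [mul_nonneg (sub_nonneg.2 hz2) (sub_nonneg.2 hw2)]

/-- On the closed unit disk `|1 - z| / |1 - ρ z|` is largest at `z = -1`. -/
lemma one_add_mul_norm_one_sub_le {ρ : ℝ} (h0 : 0 ≤ ρ) (h1 : ρ ≤ 1) {z : ℂ} (hz : ‖z‖ ≤ 1) :
    (1 + ρ) * ‖1 - z‖ ≤ 2 * ‖1 - ρ * z‖ := by
  have hx : -1 ≤ z.re := by linarith [neg_abs_le z.re, Complex.abs_re_le_norm z]
  have ht := re_sq_add_im_sq_le_one hz
  refine abs_le_of_sq_le_sq' ?_ (by positivity) |>.2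
  rw [mul_pow, mul_pow, Complex.sq_norm, Complex.sq_norm, Complex.normSq_apply,
    Complex.normSq_apply]
  simp
  -- The right side minus the left side, factored.
  have key : 0 ≤ (1 - ρ) *
      (2 * (1 - ρ) * (z.re + 1) + (1 + 3 * ρ) * (1 - (z.re ^ 2 + z.im ^ 2))) := by
    apply mul_nonneg (by linarith)
    have := mul_nonneg (sub_nonneg.2 h1) (by linarith : 0 ≤ z.re + 1)
    have := mul_nonneg (by linarith : 0 ≤ 1 + 3 * ρ) (sub_nonneg.2 ht)
    linarith
  linarith

lemma norm_sub_le_regularized {ρ : ℝ} (h0 : 0 ≤ ρ) (h1 : ρ ≤ 1) {z w : ℂ} (hz : ‖z‖ ≤ 1)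
    (hw : ‖w‖ ≤ 1) : ‖z - w‖ ≤ 2 / (1 + ρ) * ‖1 - ρ * (z * conj w)‖ := by
  have h := one_add_mul_norm_one_sub_le h0 h1 (z := z * conj w)
    (by rw [norm_mul, Complex.norm_conj]; exact mul_le_one₀ hz (norm_nonneg _) hw)
  rw [div_mul_eq_mul_div, le_div_iff₀ (by linarith)]
  nlinarith [norm_sub_le_norm_one_sub_mul_conj hz hw]

/-- Expanding `-log |1 - ρ z w̄| = ∑ m ≥ 1, Re (ρ z w̄) ^ m / m` turns the energy into
`∑ m ≥ 1, (ρ ^ m / m) |∑ z ^ m|²`, a sum of nonnegative terms of which the left side is the term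
`m = 1`. -/
lemma mul_sq_norm_sum_le_energy {ρ : ℝ} (h0 : 0 ≤ ρ) (h1 : ρ < 1) (S : Finset ℂ)
    (hS : ∀ z ∈ S, ‖z‖ ≤ 1) :
    ρ * ‖∑ z ∈ S, z‖ ^ 2 ≤ ∑ z ∈ S, ∑ w ∈ S, -Real.log ‖1 - ρ * (z * conj w)‖ := by
  have hterm : ∀ z ∈ S, ∀ w ∈ S, HasSum (fun m : ℕ ↦ ((ρ * (z * conj w)) ^ m / m : ℂ).re)
      (-Real.log ‖1 - ρ * (z * conj w)‖) := by
    intro z hz w hw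
    have hlt : ‖(ρ : ℂ) * (z * conj w)‖ < 1 := by
      rw [norm_mul, norm_mul, Complex.norm_conj, Complex.norm_real, Real.norm_of_nonneg h0]
      nlinarith [mul_le_one₀ (hS z hz) (norm_nonneg w) (hS w hw)]
    simpa [Complex.log_re] using Complex.hasSum_re (Complex.hasSum_taylorSeries_neg_log hlt)
  have hsum := hasSum_sum fun z hz ↦ hasSum_sum fun w hw ↦ hterm z hz w hw
  have hpow : ∀ m : ℕ, ∑ z ∈ S, ∑ w ∈ S, ((ρ * (z * conj w)) ^ m / m : ℂ).re =
      ρ ^ m / m * ‖∑ z ∈ S, z ^ m‖ ^ 2 := by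
    intro m
    have : (∑ z ∈ S, ∑ w ∈ S, ((ρ * (z * conj w)) ^ m / m : ℂ)) =
        ((ρ ^ m / m * ‖∑ z ∈ S, z ^ m‖ ^ 2 : ℝ) : ℂ) := by
      push_cast
      rw [← Complex.mul_conj', map_sum, Finset.sum_mul_sum, Finset.mul_sum]
      refine Finset.sum_congr rfl fun z _ ↦ ?_
      rw [Finset.mul_sum]
      refine Finset.sum_congr rfl fun w _ ↦ ?_
      rw [map_pow]
      ring
    rw [← Complex.ofReal_re (ρ ^ m / m * ‖∑ z ∈ S, z ^ m‖ ^ 2), ← this]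
    simp only [Complex.re_sum]
  simp only [hpow] at hsum
  simpa using le_hasSum hsum 1 fun m _ ↦ by positivity

/-- The regularized energy is at most the logarithmic energy of the points off the diagonal, plus
the cost `log (2 / (1 + ρ))` of regularizing each of the pairs and the diagonal terms, each at most
`-log (1 - ρ)`. -/
lemma sum_neg_log_norm_regularized_le {ρ : ℝ} (h0 : 0 ≤ ρ) (h1 : ρ < 1) (S : Finset ℂ)
    (hS : ∀ z ∈ S, ‖z‖ ≤ 1) :
    ∑ z ∈ S, ∑ w ∈ S, -Real.log ‖1 - ρ * (z * conj w)‖ ≤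
      -(∑ z ∈ S, ∑ w ∈ S.erase z, Real.log ‖z - w‖) +
        S.card * (S.card - 1) * Real.log (2 / (1 + ρ)) - S.card * Real.log (1 - ρ) := by
  have hrow : ∀ z ∈ S, ∑ w ∈ S, -Real.log ‖1 - ρ * (z * conj w)‖ ≤
      -(∑ w ∈ S.erase z, Real.log ‖z - w‖) + (S.card - 1) * Real.log (2 / (1 + ρ)) -
        Real.log (1 - ρ) := by
    intro z hz
    rw [← Finset.add_sum_erase S _ hz]
    have hdiag : -Real.log ‖1 - ρ * (z * conj z)‖ ≤ -Real.log (1 - ρ) := by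
      apply neg_le_neg
      refine Real.log_le_log (by linarith) ?_
      have : ‖(ρ : ℂ) * (z * conj z)‖ ≤ ρ := by
        rw [norm_mul, norm_mul, Complex.norm_conj, Complex.norm_real, Real.norm_of_nonneg h0]
        nlinarith [mul_le_one₀ (hS z hz) (norm_nonneg z) (hS z hz)]
      have h2 := norm_sub_norm_le (1 : ℂ) (ρ * (z * conj z))
      rw [norm_one] at h2
      linarith
    have hoff : ∀ w ∈ S.erase z, -Real.log ‖1 - ρ * (z * conj w)‖ ≤
        -Real.log ‖z - w‖ + Real.log (2 / (1 + ρ)) := by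
      intro w hw
      obtain ⟨hne, hwS⟩ := Finset.mem_erase.1 hw
      have hpos : 0 < ‖z - w‖ := norm_pos_iff.2 (sub_ne_zero.2 hne.symm)
      have hle := norm_sub_le_regularized h0 h1.le (hS z hz) (hS w hwS)
      have hc : 0 < 2 / (1 + ρ) := by positivity
      have hpos' : 0 < ‖1 - ρ * (z * conj w)‖ := pos_of_mul_pos_right (hpos.trans_le hle) hc.le
      have := Real.log_le_log hpos hle
      rw [Real.log_mul hc.ne' hpos'.ne'] at this
      linarith
    have := Finset.sum_le_sum hoff
    rw [Finset.sum_add_distrib, Finset.sum_neg_distrib fun w ↦ Real.log ‖z - w‖,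
      Finset.sum_const, nsmul_eq_mul, Finset.cast_card_erase_of_mem hz] at this
    linarith
  refine (Finset.sum_le_sum hrow).trans_eq ?_
  rw [Finset.sum_sub_distrib, Finset.sum_add_distrib, Finset.sum_neg_distrib, Finset.sum_const,
    Finset.sum_const, nsmul_eq_mul, nsmul_eq_mul]
  ring

/-! ### Simple zeros of integer polynomials -/

/-- The right side is the absolute value of the integer `Res(P, P')`, which is nonzero because the
zeros are simple. The discriminant would give one factor of the leading coefficient fewer. -/
lemma one_le_norm_leadingCoeff_pow_mul_prod_sub (P : ℤ[X]) (hP : 0 < P.natDegree)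
    (hnd : (P.map (Int.castRingHom ℂ)).roots.Nodup) :
    1 ≤ ‖(P.leadingCoeff : ℂ)‖ ^ (2 * P.natDegree - 1) *
      ∏ z ∈ (P.map (Int.castRingHom ℂ)).roots.toFinset,
        ∏ w ∈ (P.map (Int.castRingHom ℂ)).roots.toFinset.erase z, ‖z - w‖ := by
  set f := P.map (Int.castRingHom ℂ) with hf
  have hinj : Function.Injective (Int.castRingHom ℂ) := Int.cast_injective
  have hdeg : f.natDegree = P.natDegree := natDegree_map_eq_of_injective hinj P
  have hlead : f.leadingCoeff = P.leadingCoeff := by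
    rw [hf, leadingCoeff_map_of_injective hinj]; simp
  have hf0 : f ≠ 0 := by rintro h; rw [h] at hdeg; simp at hdeg; omega
  have hsp : f.Splits := IsAlgClosed.splits f
  have hval : f.roots.toFinset.val = f.roots := by simp [hnd.dedup]
  have hcard : f.roots.toFinset.card = P.natDegree := by
    rw [← hdeg, hsp.natDegree_eq_card_roots, Finset.card_def, hval]
  have hder : ∀ z ∈ f.roots.toFinset, f.derivative.eval z =
      f.leadingCoeff * ∏ w ∈ f.roots.toFinset.erase z, (z - w) := by
    intro z hz
    rw [Finset.prod_eq_multiset_prod, Finset.erase_val, hval]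
    have hfac : f = C f.leadingCoeff * (f.roots.map fun a ↦ X - C a).prod := hsp.eq_prod_roots
    conv_lhs => rw [hfac]
    rw [derivative_C_mul, eval_C_mul,
      eval_multiset_prod_X_sub_C_derivative (Multiset.mem_toFinset.1 hz)]
  have hres := resultant_eq_prod_eval f f.derivative (P.natDegree - 1)
    (by rw [← hdeg]; exact natDegree_derivative_le f) hsp
  have hprod : (f.roots.map f.derivative.eval).prod =
      f.leadingCoeff ^ P.natDegree *
        ∏ z ∈ f.roots.toFinset, ∏ w ∈ f.roots.toFinset.erase z, (z - w) := by
    rw [← hcard, ← Finset.prod_const, ← Finset.prod_mul_distrib, ← Finset.prod_congr rfl hder,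
      Finset.prod_eq_multiset_prod, hval]
  rw [hprod, ← mul_assoc, ← pow_add, hdeg, hlead, hf, derivative_map, resultant_map_map, ← hf,
    show P.natDegree - 1 + P.natDegree = 2 * P.natDegree - 1 by omega] at hres
  have hne : resultant P P.derivative P.natDegree (P.natDegree - 1) ≠ 0 := by
    intro h0
    rw [h0, map_zero, eq_comm, mul_eq_zero] at hres
    rcases hres with h | h
    · refine hf0 (leadingCoeff_eq_zero.1 ?_)
      rw [hlead]; exact eq_zero_of_pow_eq_zero h
    · obtain ⟨z, -, h⟩ := Finset.prod_eq_zero_iff.1 h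
      obtain ⟨w, hw, h⟩ := Finset.prod_eq_zero_iff.1 h
      exact (Finset.mem_erase.1 hw).1 (sub_eq_zero.1 h).symm
  have hnorm := congrArg norm hres
  simp only [norm_mul, norm_pow, norm_prod] at hnorm
  rw [← hnorm]
  simp only [eq_intCast, Complex.norm_intCast]
  exact_mod_cast Int.one_le_abs hne

lemma abs_coeff_natDegree_sub_one_eq (P : ℤ[X]) (hP : 0 < P.natDegree)
    (hnd : (P.map (Int.castRingHom ℂ)).roots.Nodup) :
    |(P.coeff (P.natDegree - 1) : ℝ)| = |(P.leadingCoeff : ℝ)| *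
      ‖∑ z ∈ (P.map (Int.castRingHom ℂ)).roots.toFinset, z‖ := by
  set f := P.map (Int.castRingHom ℂ) with hf
  have hinj : Function.Injective (Int.castRingHom ℂ) := Int.cast_injective
  have hlead : f.leadingCoeff = P.leadingCoeff := by
    rw [hf, leadingCoeff_map_of_injective hinj]; simp
  have hval : f.roots.toFinset.val = f.roots := by simp [hnd.dedup]
  have h := (IsAlgClosed.splits f).nextCoeff_eq_neg_sum_roots_mul_leadingCoeff
  rw [hf, nextCoeff_map hinj, nextCoeff_of_natDegree_pos hP, ← hf, hlead] at h
  have hs : ∑ z ∈ f.roots.toFinset, z = f.roots.sum := by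
    rw [Finset.sum_eq_multiset_sum, hval, Multiset.map_id']
  have := congrArg norm h
  simpa [hs] using this


/-- If the leading coefficient is at most `n` in absolute value, the logarithmic energy of the zeros
is at most `2 n log n`, so the energy inequality bounds their sum by a multiple of
`√(n log n)`. -/
lemma abs_coeff_natDegree_sub_one_le (P : ℤ[X]) (h3 : 3 ≤ P.natDegree)
    (hroot : ∀ z : ℂ, aeval z P = 0 → ‖z‖ ≤ 1)
    (hnd : (P.map (Int.castRingHom ℂ)).roots.Nodup)
    (hlead : |(P.leadingCoeff : ℝ)| ≤ P.natDegree) :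
    |(P.coeff (P.natDegree - 1) : ℝ)| ≤ |(P.leadingCoeff : ℝ)| *
      (8 * Real.sqrt (P.natDegree * Real.log P.natDegree)) := by
  rw [abs_coeff_natDegree_sub_one_eq P (by omega) hnd]
  refine mul_le_mul_of_nonneg_left ?_ (abs_nonneg _)
  have hprod := one_le_norm_leadingCoeff_pow_mul_prod_sub P (by omega) hnd
  set f := P.map (Int.castRingHom ℂ) with hf
  set S := f.roots.toFinset with hSdef
  set n := P.natDegree with hn
  have hinj : Function.Injective (Int.castRingHom ℂ) := Int.cast_injective
  have hcard : S.card = n := by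
    rw [hn, ← natDegree_map_eq_of_injective hinj P, ← hf,
      (IsAlgClosed.splits f).natDegree_eq_card_roots, Multiset.toFinset_card_of_nodup hnd]
  have hS : ∀ z ∈ S, ‖z‖ ≤ 1 := by
    intro z hz
    refine hroot z ?_
    have h := isRoot_of_mem_roots (Multiset.mem_toFinset.1 hz)
    rwa [hf, IsRoot.def, eval_map] at h
  have hn3 : (3 : ℝ) ≤ n := by exact_mod_cast h3
  have hn0 : (n : ℝ) ≠ 0 := by positivity
  have hL1 : 1 ≤ Real.log n := by
    rw [Real.le_log_iff_exp_le (by positivity)]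
    linarith [Real.exp_one_lt_d9]
  have ha0 : P.leadingCoeff ≠ 0 := by
    rw [Ne, leadingCoeff_eq_zero]; rintro rfl; simp at hn; omega
  have hapos : 0 < |(P.leadingCoeff : ℝ)| := abs_pos.2 (by exact_mod_cast ha0)
  rw [Complex.norm_intCast] at hprod
  have hdist : -(∑ z ∈ S, ∑ w ∈ S.erase z, Real.log ‖z - w‖) ≤ 2 * n * Real.log n := by
    have hne : ∀ z ∈ S, ∀ w ∈ S.erase z, ‖z - w‖ ≠ 0 := fun z _ w hw ↦
      norm_ne_zero_iff.2 (sub_ne_zero.2 (Finset.mem_erase.1 hw).1.symm)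
    have hlog := Real.log_nonneg hprod
    rw [Real.log_mul (by positivity)
        (Finset.prod_ne_zero_iff.2 fun z hz ↦ Finset.prod_ne_zero_iff.2 (hne z hz)),
      Real.log_pow, Real.log_prod fun z hz ↦ Finset.prod_ne_zero_iff.2 (hne z hz),
      Finset.sum_congr rfl fun z hz ↦ Real.log_prod (hne z hz)] at hlog
    have h1 : Real.log |(P.leadingCoeff : ℝ)| ≤ Real.log n := Real.log_le_log hapos hlead
    have h2 : ((2 * n - 1 : ℕ) : ℝ) * Real.log |(P.leadingCoeff : ℝ)| ≤ 2 * n * Real.log n := by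
      refine mul_le_mul (by exact_mod_cast Nat.sub_le _ _) h1
        (Real.log_nonneg ?_) (by positivity)
      exact_mod_cast Int.one_le_abs ha0
    linarith
  -- The regularization `ρ = 1 - 1 / n` costs `O(n)` off the diagonal and `n log n` on it.
  have hρ : 2 / 3 ≤ 1 - 1 / (n : ℝ) := by
    have : 1 / (n : ℝ) ≤ 1 / 3 := by gcongr
    linarith
  have hρ1 : 1 - 1 / (n : ℝ) < 1 := by
    have : 0 < 1 / (n : ℝ) := by positivity
    linarith
  have hlow := mul_sq_norm_sum_le_energy (by linarith) hρ1 S hS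
  have hup := sum_neg_log_norm_regularized_le (by linarith) hρ1 S hS
  rw [hcard, sub_sub_cancel, Real.log_div one_ne_zero hn0, Real.log_one] at hup
  have hoff : (n : ℝ) * (n - 1) * Real.log (2 / (1 + (1 - 1 / (n : ℝ)))) ≤ n := by
    have h1 : Real.log (2 / (1 + (1 - 1 / (n : ℝ)))) ≤ 1 / n := by
      refine (Real.log_le_sub_one_of_pos (div_pos two_pos (by linarith))).trans ?_
      rw [sub_le_iff_le_add, div_le_iff₀ (by linarith)]
      have : 0 ≤ 1 / (n : ℝ) := by positivity
      nlinarith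
    calc (n : ℝ) * (n - 1) * Real.log (2 / (1 + (1 - 1 / (n : ℝ))))
        ≤ n * (n - 1) * (1 / n) :=
          mul_le_mul_of_nonneg_left h1 (mul_nonneg (by positivity) (by linarith))
      _ ≤ n := by field_simp; linarith
  have hsq : ‖∑ z ∈ S, z‖ ^ 2 ≤ 64 * (n * Real.log n) := by
    have hnL : (n : ℝ) ≤ n * Real.log n := le_mul_of_one_le_right (by positivity) hL1
    nlinarith [sq_nonneg ‖∑ z ∈ S, z‖]
  refine abs_le_of_sq_le_sq' ?_ (by positivity) |>.2
  rw [mul_pow, Real.sq_sqrt (by positivity)]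
  linarith

/-! ### Products of cyclotomic polynomials of prime index -/

/-- Chebyshev's lower bound for `π`. -/
lemma div_four_le_primeCounting_mul_log {p : ℕ} (hp : 4 ≤ p) :
    (p : ℝ) / 4 ≤ Nat.primeCounting p * Real.log p := by
  have h := (Chebyshev.psi_ge p).trans (Chebyshev.psi_le_primeCounting_mul_log p)
  have hp' : (4 : ℝ) ≤ p := by exact_mod_cast hp
  -- `log y ≤ y - 1` at `y = (p + 1) / 8`.
  have hlog : Real.log (p + 1) ≤ (p + 1) / 8 - 1 + 3 * Real.log 2 := by
    have h8 : Real.log 8 = 3 * Real.log 2 := by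
      rw [show (8 : ℝ) = 2 ^ 3 by norm_num, Real.log_pow]; norm_num
    have h1 := Real.log_le_sub_one_of_pos (show (0 : ℝ) < (p + 1) / 8 by positivity)
    rw [Real.log_div (by positivity) (by norm_num)] at h1
    linarith
  nlinarith [Real.log_two_gt_d9, Real.log_two_lt_d9]

lemma nextCoeff_cyclotomic_prime {p : ℕ} (hp : p.Prime) : (cyclotomic p ℤ).nextCoeff = 1 := by
  have : Fact p.Prime := ⟨hp⟩
  have hdeg : (cyclotomic p ℤ).natDegree = p - 1 := by
    rw [natDegree_cyclotomic, Nat.totient_prime hp]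
  have h2 := hp.two_le
  rw [nextCoeff_of_natDegree_pos (by omega), hdeg, cyclotomic_prime, finsetSum_coeff]
  simp [coeff_X_pow]
  omega

lemma norm_eq_one_of_aeval_cyclotomic_eq_zero {q : ℕ} (hq : q ≠ 0) {z : ℂ}
    (hz : aeval z (cyclotomic q ℤ) = 0) : ‖z‖ = 1 := by
  have h : (cyclotomic q ℂ).IsRoot z := by
    rw [IsRoot.def, ← map_cyclotomic_int, eval_map]
    exact hz
  exact Complex.norm_eq_one_of_pow_eq_one
    (isRoot_of_unity_of_root_cyclotomic (Nat.mem_divisors_self q hq) h) hq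

/-- The integer multiple `m ∏ Φ_q` of the product of the cyclotomic polynomials of prime index
`q ≤ p`. -/
noncomputable def cyclotomicPrimeProd (m : ℤ) (p : ℕ) : ℤ[X] :=
  C m * ∏ q ∈ Nat.primesLE p, cyclotomic q ℤ

lemma natDegree_cyclotomicPrimeProd {m : ℤ} (hm : m ≠ 0) (p : ℕ) :
    (cyclotomicPrimeProd m p).natDegree = ∑ q ∈ Nat.primesLE p, (q - 1) := by
  rw [cyclotomicPrimeProd, natDegree_C_mul hm,
    natDegree_prod_of_monic _ _ fun q _ ↦ cyclotomic.monic q ℤ]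
  refine Finset.sum_congr rfl fun q hq ↦ ?_
  rw [natDegree_cyclotomic, Nat.totient_prime (Nat.prime_of_mem_primesLE hq)]

lemma leadingCoeff_cyclotomicPrimeProd (m : ℤ) (p : ℕ) :
    (cyclotomicPrimeProd m p).leadingCoeff = m := by
  rw [cyclotomicPrimeProd, leadingCoeff_mul, leadingCoeff_C,
    (monic_prod_of_monic _ _ fun q _ ↦ cyclotomic.monic q ℤ).leadingCoeff, mul_one]

lemma nextCoeff_cyclotomicPrimeProd (m : ℤ) (p : ℕ) :
    (cyclotomicPrimeProd m p).nextCoeff = m * Nat.primeCounting p := by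
  rw [cyclotomicPrimeProd, nextCoeff_C_mul,
    Monic.nextCoeff_prod _ _ fun q _ ↦ cyclotomic.monic q ℤ,
    Finset.sum_congr rfl fun q hq ↦ nextCoeff_cyclotomic_prime (Nat.prime_of_mem_primesLE hq)]
  simp [Nat.primesLE_card_eq_primeCounting]

lemma nodup_roots_cyclotomicPrimeProd {m : ℤ} (hm : m ≠ 0) (p : ℕ) :
    ((cyclotomicPrimeProd m p).map (Int.castRingHom ℂ)).roots.Nodup := by
  rw [cyclotomicPrimeProd, Polynomial.map_mul, map_C, Polynomial.map_prod,
    roots_C_mul _ (by simpa using hm)]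
  simp only [map_cyclotomic_int]
  refine nodup_roots (separable_prod' (fun q _ r _ hqr ↦ ?_) fun q hq ↦ ?_)
  · simpa using (cyclotomic.isCoprime_rat hqr).map (mapRingHom (algebraMap ℚ ℂ))
  · have : NeZero (q : ℂ) :=
      ⟨Nat.cast_ne_zero.2 (Nat.prime_of_mem_primesLE hq).ne_zero⟩
    exact separable_cyclotomic q ℂ

lemma norm_eq_one_of_aeval_cyclotomicPrimeProd_eq_zero {m : ℤ} (hm : m ≠ 0) {p : ℕ} {z : ℂ}
    (hz : aeval z (cyclotomicPrimeProd m p) = 0) : ‖z‖ = 1 := by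
  rw [cyclotomicPrimeProd, map_mul, aeval_C, map_prod, mul_eq_zero] at hz
  obtain ⟨q, hq, h⟩ := Finset.prod_eq_zero_iff.1 (hz.resolve_left (by simpa using hm))
  exact norm_eq_one_of_aeval_cyclotomic_eq_zero (Nat.prime_of_mem_primesLE hq).ne_zero h

lemma sub_one_le_sum_primesLE {p : ℕ} (hp : p.Prime) : p - 1 ≤ ∑ q ∈ Nat.primesLE p, (q - 1) :=
  Finset.single_le_sum (f := fun q ↦ q - 1) (fun _ _ ↦ Nat.zero_le _)
    (Nat.mem_primesLE.2 ⟨le_rfl, hp⟩)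

/-- With `n = ∑ q ≤ p, (q - 1)` one has `n ≤ p π(p)` and `log n ≥ (log p) / 2`, and Chebyshev's
bound gives `p ≤ 4 π(p) log p`; hence `n / log n ≤ 8 π(p)²`. -/
lemma sqrt_sum_div_log_le_primeCounting {p : ℕ} (hp : p.Prime) (h4 : 4 ≤ p) :
    Real.sqrt (((∑ q ∈ Nat.primesLE p, (q - 1) : ℕ) : ℝ) /
      Real.log (∑ q ∈ Nat.primesLE p, (q - 1) : ℕ)) ≤ 3 * Nat.primeCounting p := by
  set n := ∑ q ∈ Nat.primesLE p, (q - 1) with hn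
  have hpn : p - 1 ≤ n := sub_one_le_sum_primesLE hp
  have hnp : (n : ℝ) ≤ Nat.primeCounting p * p := by
    have : n ≤ (Nat.primesLE p).card • p :=
      Finset.sum_le_card_nsmul _ _ _ fun q hq ↦
        (Nat.sub_le _ _).trans (Nat.le_of_mem_primesLE hq)
    rw [Nat.primesLE_card_eq_primeCounting, smul_eq_mul] at this
    exact_mod_cast this
  have hp4 : (4 : ℝ) ≤ p := by exact_mod_cast h4
  have hlogp : 0 < Real.log p := Real.log_pos (by linarith)
  have hpn2 : (p : ℝ) ≤ (n : ℝ) ^ 2 := by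
    have : p ≤ n ^ 2 := by nlinarith [show 3 ≤ n by omega, show p ≤ n + 1 by omega]
    exact_mod_cast this
  have hlog : Real.log p ≤ 2 * Real.log n := by
    have := Real.log_le_log (by linarith) hpn2
    rwa [Real.log_pow, Nat.cast_ofNat] at this
  have hcheb := div_four_le_primeCounting_mul_log h4
  refine Real.sqrt_le_iff.2 ⟨by positivity, ?_⟩
  rw [div_le_iff₀ (by linarith)]
  have hπ : (0 : ℝ) ≤ Nat.primeCounting p := Nat.cast_nonneg _
  calc (n : ℝ) ≤ Nat.primeCounting p * p := hnp
    _ ≤ Nat.primeCounting p * (4 * (Nat.primeCounting p * (2 * Real.log n))) := by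
        refine mul_le_mul_of_nonneg_left ?_ hπ
        nlinarith
    _ ≤ (3 * Nat.primeCounting p) ^ 2 * Real.log n := by
        nlinarith [mul_nonneg (sq_nonneg (Nat.primeCounting p : ℝ))
          (by linarith : 0 ≤ Real.log n)]

theorem theorem2p5 :
    (∀ M : ℝ, 0 < M → ∀ n : ℕ, max M 55 ≤ (n : ℝ) →
      ∀ P ∈ intPolysSimpleBdd n (Metric.closedBall (0 : ℂ) 1) M,
        |(P.coeff (n - 1) : ℝ)| ≤ 8 * M * Real.sqrt ((n : ℝ) * Real.log (n : ℝ))) ∧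
    (∃ c : ℝ, 0 < c ∧ ∀ M : ℝ, 1 ≤ M → ∃ᶠ n : ℕ in atTop,
      ∃ P ∈ intPolysSimpleBdd n (Metric.closedBall (0 : ℂ) 1) M,
        c * M * Real.sqrt ((n : ℝ) / Real.log (n : ℝ)) ≤ |(P.coeff (n - 1) : ℝ)|) := by
  refine ⟨?_, 1 / 6, by norm_num, ?_⟩
  · rintro M - n hn P ⟨⟨⟨hdeg, hroot⟩, hnd⟩, hlead⟩
    obtain ⟨hMn, hn55⟩ := max_le_iff.1 hn
    obtain rfl : P.natDegree = n := natDegree_eq_of_degree_eq_some hdeg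
    have h55 : 55 ≤ P.natDegree := by exact_mod_cast hn55
    refine (abs_coeff_natDegree_sub_one_le P (by omega)
      (fun z hz ↦ by simpa using hroot z hz) hnd (hlead.trans hMn)).trans ?_
    rw [mul_comm 8 M, mul_assoc M]
    exact mul_le_mul_of_nonneg_right hlead (by positivity)
  · intro M hM
    rw [frequently_atTop]
    intro N
    obtain ⟨p, hpN, hp⟩ := Nat.exists_infinite_primes (N + 4)
    have hm1 : 1 ≤ ⌊M⌋ := Int.le_floor.2 (by exact_mod_cast hM)
    have hm0 : ⌊M⌋ ≠ 0 := by omega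
    have hdeg := natDegree_cyclotomicPrimeProd hm0 p
    have hpn := sub_one_le_sum_primesLE hp
    have hm1' : (1 : ℝ) ≤ ⌊M⌋ := by exact_mod_cast hm1
    have hsqrt := sqrt_sum_div_log_le_primeCounting hp (by omega)
    have hnext := nextCoeff_cyclotomicPrimeProd ⌊M⌋ p
    rw [nextCoeff_of_natDegree_pos (by omega)] at hnext
    have hlc := leadingCoeff_cyclotomicPrimeProd ⌊M⌋ p
    rw [leadingCoeff] at hlc
    rw [← hdeg] at hpn hsqrt
    refine ⟨(cyclotomicPrimeProd ⌊M⌋ p).natDegree, by omega, cyclotomicPrimeProd ⌊M⌋ p,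
      ⟨⟨⟨degree_eq_natDegree ?_, fun z hz ↦ ?_⟩, nodup_roots_cyclotomicPrimeProd hm0 p⟩, ?_⟩, ?_⟩
    · rintro h
      simp [h] at hpn
      omega
    · simpa using (norm_eq_one_of_aeval_cyclotomicPrimeProd_eq_zero hm0 hz).le
    · rw [hlc, abs_of_nonneg (by linarith)]
      exact Int.floor_le M
    · rw [hnext]
      push_cast
      rw [abs_of_nonneg (by positivity)]
      have hfloor : M / 2 ≤ ⌊M⌋ := by linarith [Int.lt_floor_add_one M]
      calc 1 / 6 * M * Real.sqrt _ ≤ 1 / 6 * M * (3 * Nat.primeCounting p) :=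
            mul_le_mul_of_nonneg_left hsqrt (by positivity)
        _ = M / 2 * Nat.primeCounting p := by ring
        _ ≤ ⌊M⌋ * Nat.primeCounting p := mul_le_mul_of_nonneg_right hfloor (by positivity)
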